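/- A $\Box$-set $X$ (pre-cubical set) consists of sets $X_n$ ($n\ge 0$) of $n$-cubes and face maps $d_i^{\alpha}\colon X_n\to X_{n-1}$ ($n\ge 1$, $1\le i\le n$, $\alpha\in\{0,1\}$) with $d_i^{\alpha}d_j^{\beta}=d_{j-1}^{\beta}d_i^{\alpha}$ for $i<j$; elements of $X_0$ are vertices. With $I=[0,1]$, its geometric realization $|X|$ is the quotient space of $\coprod_{n\ge 0}X_n\times I^n$ ($X_n$ discrete) by the equivalence relation generated by $(d_i^{\alpha}c,x)\sim(c,\delta_i^{\alpha}x)$, where $\delta_i^{\alpha}(x_1,\dots,x_{n-1})=(x_1,\dots,x_{i-1},\alpha,x_i,\dots,x_{n-1})$; the class of $(c,x)$ is written $[c;x]$. A continuous path $\beta$ from a closed interval to $I^n$ is increasing if every coordinate $\beta_i$ is non-decreasing, and strictly increasing if moreover $\beta_i(t)=\beta_i(t')$ implies $t=t'$ or $\beta_i(t)\in\{0,1\}$. A presentation of a continuous path $p\colon I\to|X|$ consists of numbers $0=t_0\le t_1\le\dots\le t_l=1$, cubes $c_1,\dots,c_l$ of $X$ and continuous increasing paths $\beta_i\colon[t_{i-1},t_i]\to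 I^{\dim c_i}$ such that $p(t)=[c_i;\beta_i(t)]$ for $t_{i-1}\le t\le t_i$. A path $p$ that has a presentation is a d-path; it is strict if it has a presentation in which all $\beta_i$ are strictly increasing, and tame if it has a presentation in which $p(t_i)$ is a vertex for every $0\le i\le l$. Let $X$ be an arbitrary $\Box$-set with selected vertices $x^-,x^+\in X_0$. Let $\vec{S}(X)_{x^-}^{x^+}$ be the space of strict d-paths $p$ with $p(0)=x^-$ and $p(1)=x^+$, and $\vec{ST}(X)_{x^-}^{x^+}$ its subspace of those that are also tame, both with the topology induced from the compact-open topology on $|X|^I$. Then the inclusion map $$\iota\colon\vec{ST}(X)_{x^-}^{x^+}\hookrightarrow\vec{S}(X)_{x^-}^{x^+}$$ is a homotopy equivalence. -/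

import Mathlib

open scoped unitInterval

universe u

/-- A `□`-set (pre-cubical set): sets of `n`-cubes with face maps `d_i^α`, where the coordinate `i`
is counted from `0` and `α = false, true` stands for `0, 1`. The axiom is
`d_i^α d_j^β = d_{j-1}^β d_i^α` for `i < j`, written with `j = k + 1`, `i ≤ k`. -/
structure BoxSet where
  /-- the `n`-cubes -/
  cube : ℕ → Type u
  /-- the face maps -/
  face : ∀ {n : ℕ}, Fin (n + 1) → Bool → cube (n + 1) → cube n
  face_face : ∀ {n : ℕ} (i k : Fin (n + 1)) (α β : Bool) (c : cube (n + 2)), i ≤ k →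
    face i α (face k.succ β c) = face k β (face i.castSucc α c)

namespace BoxSet

/-- The standard cube `I^n` with the product topology and the product order. -/
abbrev StdCube (n : ℕ) : Type := Fin n → I

/-- The end point `0` or `1` of `I` given by a sign. -/
def endpt (α : Bool) : I := if α then 1 else 0

/-- The coface map `δ_i^α : I^n → I^{n+1}`, inserting `α` as the coordinate number `i`. -/
def coface {n : ℕ} (i : Fin (n + 1)) (α : Bool) (x : StdCube n) : StdCube (n + 1) :=
  i.insertNth (α := fun _ => I) (endpt α) x

/-- The disjoint union of the standard cubes, one copy of `I^n` for every `n`-cube of `X`, with the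
disjoint union topology. -/
abbrev PreRealization (X : BoxSet.{u}) : Type u := Σ c : (Σ n : ℕ, X.cube n), StdCube c.1

/-- The elementary identifications `(d_i^α c, x) ∼ (c, δ_i^α x)`. -/
inductive Glue (X : BoxSet.{u}) : X.PreRealization → X.PreRealization → Prop
  | face {n : ℕ} (i : Fin (n + 1)) (α : Bool) (c : X.cube (n + 1)) (x : StdCube n) :
      Glue X ⟨⟨n, X.face i α c⟩, x⟩ ⟨⟨n + 1, c⟩, coface i α x⟩

/-- The geometric realization: the quotient space of the disjoint union of cubes by the equivalence
relation generated by the elementary identifications, with the quotient topology. -/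
abbrev Realization (X : BoxSet.{u}) : Type u := Quot X.Glue

/-- The quotient map `I^n → |X|`, `x ↦ [c; x]` of an `n`-cube `c`. -/
def toReal (X : BoxSet.{u}) {n : ℕ} (c : X.cube n) (x : StdCube n) : X.Realization :=
  Quot.mk X.Glue ⟨⟨n, c⟩, x⟩

/-- The point of the realization given by a vertex. -/
def vertexPt (X : BoxSet.{u}) (v : X.cube 0) : X.Realization := X.toReal v Fin.elim0

/-- A path `J → I^n` is increasing if all its coordinates are non-decreasing. -/
def Increasing {n : ℕ} {J : Set I} (b : C(J, StdCube n)) : Prop :=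
  ∀ i : Fin n, ∀ s t : J, s ≤ t → b s i ≤ b t i

/-- A path `J → I^n` is strictly increasing if it is increasing and a coordinate takes no value
other than `0` and `1` twice. -/
def StrictlyIncreasing {n : ℕ} {J : Set I} (b : C(J, StdCube n)) : Prop :=
  Increasing b ∧ ∀ i : Fin n, ∀ s t : J, b s i = b t i → s = t ∨ b s i = 0 ∨ b s i = 1

/-- A presentation `[c_1; β_1] *_{t_1} ⋯ *_{t_{l-1}} [c_l; β_l]` of a path `p` in `|X|`
by increasing paths `β_i` in cubes. -/
structure Presentation (X : BoxSet.{u}) (p : C(I, X.Realization)) where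
  /-- the number of segments -/
  len : ℕ
  /-- the subdivision of the unit interval -/
  time : Fin (len + 1) → I
  time_mono : Monotone time
  time_zero : time 0 = 0
  time_last : time (Fin.last len) = 1
  /-- the dimensions of the cubes -/
  dim : Fin len → ℕ
  /-- the cubes `c_i` -/
  cell : ∀ i : Fin len, X.cube (dim i)
  /-- the paths `β_i : [t_{i-1}, t_i] → I^{dim c_i}` -/
  seg : ∀ i : Fin len, C(Set.Icc (time i.castSucc) (time i.succ), StdCube (dim i))
  seg_increasing : ∀ i : Fin len, Increasing (seg i)
  eq_seg : ∀ (i : Fin len) (s : Set.Icc (time i.castSucc) (time i.succ)),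
    p s = X.toReal (cell i) (seg i s)

/-- A path is strictly directed if it has a presentation by strictly increasing paths. -/
def IsStrict (X : BoxSet.{u}) (p : C(I, X.Realization)) : Prop :=
  ∃ P : X.Presentation p, ∀ i : Fin P.len, StrictlyIncreasing (P.seg i)

/-- A d-path is tame if it has a presentation such that it is at a vertex at all the times of the
subdivision. -/
def IsTame (X : BoxSet.{u}) (p : C(I, X.Realization)) : Prop :=
  ∃ P : X.Presentation p, ∀ i : Fin (P.len + 1), ∃ v : X.cube 0, p (P.time i) = X.vertexPt v

/-- The strict d-paths from `x` to `y`, with the compact-open topology. -/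
def strictPaths (X : BoxSet.{u}) (x y : X.cube 0) : Set C(I, X.Realization) :=
  {p | X.IsStrict p ∧ p 0 = X.vertexPt x ∧ p 1 = X.vertexPt y}

/-- The strict tame d-paths from `x` to `y`, with the compact-open topology. -/
def strictTamePaths (X : BoxSet.{u}) (x y : X.cube 0) : Set C(I, X.Realization) :=
  {p | (X.IsStrict p ∧ X.IsTame p) ∧ p 0 = X.vertexPt x ∧ p 1 = X.vertexPt y}

theorem strictTamePaths_subset (X : BoxSet.{u}) (x y : X.cube 0) :
    X.strictTamePaths x y ⊆ X.strictPaths x y :=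
  fun _ hp => ⟨hp.1.1, hp.2⟩

/-- The inclusion of the space of strict tame d-paths into the space of strict d-paths. -/
def tameInclusion (X : BoxSet.{u}) (x y : X.cube 0) :
    C(X.strictTamePaths x y, X.strictPaths x y) :=
  ⟨Set.inclusion (X.strictTamePaths_subset x y), continuous_inclusion _⟩

end BoxSet

/-- A continuous map is a homotopy equivalence if it is the underlying map of one. -/
def IsHomotopyEquivalence {A B : Type*} [TopologicalSpace A] [TopologicalSpace B]
    (f : C(A, B)) : Prop :=
  ∃ e : ContinuousMap.HomotopyEquiv A B, e.toFun = f

namespace BoxSet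

variable {X : BoxSet.{u}}

/-! ### Cofaces and reduction to faces -/

/-! A non-decreasing self-map of `I` fixing 0 and 1 acts on all coordinates of all cubes, compatibly
with the gluing, and fixes vertices. Stretching from the centre by a factor at least 1, with
cut-off, is moreover injective away from the values 0 and 1, so it preserves both strictness and
tameness. It therefore suffices to choose a factor, continuously in the strict path p, that makes p
tame; lowering the factor linearly to 1 is then a homotopy to the identity on both spaces, and the
stretching is a homotopy inverse of the inclusion.

A large factor makes p tame for two reasons. By strictness, a coordinate takes the value 1/2 at most
once per segment, so the times at which some coordinate is 1/2 are finite in number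
(`IsStrict.finite_centreDist_eq_zero`). Arbitrarily fine subdivisions thus avoid them, and at the
chosen times a large factor moves p to vertices. Between two such times p may cross many cubes, but
it moves little: a coordinate that leaves 0 there stays small, and one that is 1 stays 1 as long as
the path runs in the same cube. Collapsing a neighbourhood of 0 thus pushes the whole piece into one
cube (`PushedIntoCube.extend`). Movement is measured by the sum of coordinates modulo 1, which is
well defined on the realization because passing to a face changes the sum by 0 or 1.

For continuity, the inverse of the factor is a weighted mean over all grids of bounds that are
continuous in p. A mean does not exceed all of its terms, so some grid works
(`exists_tameRadius_le`). -/

theorem endpt_injective : Function.Injective endpt := by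
  intro α β h
  cases α <;> cases β <;> simp [endpt] at h ⊢

@[simp] theorem coface_same {n : ℕ} (i : Fin (n + 1)) (α : Bool) (x : StdCube n) :
    coface i α x i = endpt α := by simp [coface]

@[simp] theorem coface_succAbove {n : ℕ} (i : Fin (n + 1)) (α : Bool) (x : StdCube n)
    (j : Fin n) : coface i α x (i.succAbove j) = x j := by simp [coface]

theorem coface_eq_iff {n : ℕ} (i : Fin (n + 1)) (α : Bool) (x : StdCube n)
    (y : StdCube (n + 1)) :
    coface i α x = y ↔ endpt α = y i ∧ ∀ j, x j = y (i.succAbove j) := by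
  refine ⟨fun h => h ▸ by simp, fun ⟨h₁, h₂⟩ => funext fun j => ?_⟩
  induction j using Fin.succAboveCases i with
  | x => simpa using h₁
  | p j => simpa using h₂ j

theorem coface_injective {n : ℕ} (i : Fin (n + 1)) (α : Bool) :
    Function.Injective (coface i α) := by
  intro x y h
  funext j
  simpa using congrFun h (i.succAbove j)

theorem castSucc_succAbove_succAbove {n : ℕ} {i k : Fin (n + 1)} (h : i ≤ k) (m : Fin n) :
    i.castSucc.succAbove (k.succAbove m) = k.succ.succAbove (i.succAbove m) := by
  rw [Fin.le_def] at h
  ext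
  simp only [Fin.succAbove, Fin.lt_def]
  split_ifs <;> simp_all <;> omega

theorem coface_coface {n : ℕ} {i k : Fin (n + 1)} (h : i ≤ k) (α β : Bool) (z : StdCube n) :
    coface i.castSucc α (coface k β z) = coface k.succ β (coface i α z) := by
  rw [coface_eq_iff]
  constructor
  · rw [← Fin.succAbove_of_castSucc_lt k.succ i (by simpa [Fin.lt_def, Nat.lt_succ_iff] using h)]
    simp
  · intro l
    induction l using Fin.succAboveCases k with
    | x => rw [Fin.succAbove_castSucc_of_le _ _ h]; simp
    | p m => rw [castSucc_succAbove_succAbove h]; simp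

/-- One step of reduction of a point of a cube to a point of a face of this cube. -/
def Red (X : BoxSet.{u}) (a b : X.PreRealization) : Prop := X.Glue b a

/-- The point has end point values in both coordinates i and j. Dropping both, in either order,
gives the same point of the same face by the cubical identity. -/
theorem red_diamond_of_lt {n : ℕ} {i j : Fin (n + 1)} (hij : i < j) (α β : Bool)
    (c : X.cube (n + 1)) {x y : StdCube n} (h : coface i α x = coface j β y) :
    ∃ d, X.Red ⟨⟨n, X.face i α c⟩, x⟩ d ∧ X.Red ⟨⟨n, X.face j β c⟩, y⟩ d := by
  obtain _ | n := n
  · exact absurd hij (by rw [Fin.lt_def]; lia)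
  obtain ⟨k, rfl⟩ := Fin.exists_succ_eq.2 (Fin.ne_zero_of_lt hij)
  obtain ⟨i, rfl⟩ := Fin.exists_castSucc_eq.2 (Fin.ne_last_of_lt hij)
  have hik : i ≤ k := by simpa [Fin.lt_def, Nat.lt_succ_iff] using hij
  have hxk : x k = endpt β := by
    have := congrFun h k.succ
    rwa [coface_same, ← Fin.succAbove_castSucc_of_le _ _ hik, coface_succAbove] at this
  set z : StdCube n := fun m => x (k.succAbove m)
  have hx : coface k β z = x := (coface_eq_iff _ _ _ _).2 ⟨hxk.symm, fun _ => rfl⟩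
  have hy : coface i α z = y := by
    apply coface_injective k.succ β
    rw [← coface_coface hik, hx, h]
  refine ⟨⟨⟨n, X.face k β (X.face i.castSucc α c)⟩, z⟩, ?_, ?_⟩
  · rw [← hx]
    exact Glue.face _ _ _ _
  · rw [← hy, ← X.face_face i k α β c hik]
    exact Glue.face _ _ _ _

/-- Local confluence with at most one step on one side, the form from which the Church–Rosser
property follows without a termination argument. -/
theorem red_diamond (a b c : X.PreRealization) (hb : X.Red a b) (hc : X.Red a c) :
    ∃ d, Relation.ReflGen X.Red b d ∧ Relation.ReflTransGen X.Red c d := by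
  obtain ⟨i, α, e, x⟩ := hb
  generalize hy : coface i α x = y at hc
  obtain ⟨j, β, _, x'⟩ := hc
  rcases lt_trichotomy i j with h | rfl | h
  · obtain ⟨d, h₁, h₂⟩ := red_diamond_of_lt h α β e hy
    exact ⟨d, .single h₁, .single h₂⟩
  · have hα : α = β := endpt_injective (by simpa using congrFun hy i)
    subst hα
    obtain rfl := coface_injective i α hy
    exact ⟨_, .refl, .refl⟩
  · obtain ⟨d, h₁, h₂⟩ := red_diamond_of_lt h β α e hy.symm
    exact ⟨d, .single h₂, .single h₁⟩

/-- Two points that are identified in the realization reduce to the same point of a cube. -/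
theorem join_red_of_toReal_eq {m n : ℕ} {c : X.cube m} {c' : X.cube n} {x : StdCube m}
    {x' : StdCube n} (h : X.toReal c x = X.toReal c' x') :
    Relation.Join (Relation.ReflTransGen X.Red) ⟨⟨m, c⟩, x⟩ ⟨⟨n, c'⟩, x'⟩ := by
  have he := Relation.equivalence_join_reflTransGen (red_diamond (X := X))
  have h' := Quot.eqvGen_exact h
  generalize (⟨⟨m, c⟩, x⟩ : X.PreRealization) = a, (⟨⟨n, c'⟩, x'⟩ : X.PreRealization) = b at h' ⊢
  induction h' with
  | rel a b hab => exact ⟨a, .refl, .single hab⟩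
  | refl a => exact he.refl a
  | symm a b _ ih => exact he.symm ih
  | trans a b c _ _ ih ih' => exact he.trans ih ih'

theorem toReal_face {n : ℕ} (i : Fin (n + 1)) (α : Bool) (c : X.cube (n + 1)) (x : StdCube n) :
    X.toReal (X.face i α c) x = X.toReal c (coface i α x) :=
  Quot.sound (Glue.face i α c x)

theorem continuous_coface {n : ℕ} (i : Fin (n + 1)) (α : Bool) :
    Continuous (coface (n := n) i α) := by
  refine continuous_pi fun j => ?_
  induction j using Fin.succAboveCases i with
  | x => simpa using continuous_const
  | p j => simpa using continuous_apply j

theorem monotone_coface {n : ℕ} (i : Fin (n + 1)) (α : Bool) :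
    Monotone (coface (n := n) i α) := by
  intro x y h j
  induction j using Fin.succAboveCases i with
  | x => simp
  | p j => simpa using h j

/-- The point `x` of the cube `c` lies on a face `e`, as the point `w` of it: `ψ` is the inclusion
of the face and `ι` selects the coordinates of the face. -/
structure FaceData {m n : ℕ} (c : X.cube n) (x : StdCube n) (e : X.cube m) (w : StdCube m)
    (ι : Fin m → Fin n) (ψ : StdCube m → StdCube n) : Prop where
  continuous : Continuous ψ
  monotone : Monotone ψ
  point : ψ w = x
  select : x ∘ ι = w
  toReal_eq : ∀ z, X.toReal c (ψ z) = X.toReal e z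
  retract : ∀ y : StdCube n, (∀ j, (x j = 0 → y j = 0) ∧ (x j = 1 → y j = 1)) → ψ (y ∘ ι) = y
  comp : ∀ (f : I → I), f 0 = 0 → f 1 = 1 → ∀ z, ψ (f ∘ z) = f ∘ ψ z

theorem endpt_fixed {f : I → I} (h₀ : f 0 = 0) (h₁ : f 1 = 1) (α : Bool) :
    f (endpt α) = endpt α := by
  cases α <;> simp [endpt, h₀, h₁]

theorem coface_comp {f : I → I} (h₀ : f 0 = 0) (h₁ : f 1 = 1) {n : ℕ} (i : Fin (n + 1))
    (α : Bool) (z : StdCube n) : coface i α (f ∘ z) = f ∘ coface i α z := by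
  simp [coface_eq_iff, endpt_fixed h₀ h₁]

/-- Each reduction drops a coordinate in which the point is 0 or 1. A point y with the same end
point values in these coordinates lies on the same face and is recovered from its remaining
coordinates; this is the field `retract`. -/
theorem exists_faceData {a b : X.PreRealization} (h : Relation.ReflTransGen X.Red a b) :
    ∃ ι ψ, FaceData a.1.2 a.2 b.1.2 b.2 ι ψ := by
  induction h using Relation.ReflTransGen.head_induction_on with
  | refl => exact ⟨id, id, continuous_id, monotone_id, rfl, rfl, fun _ => rfl,
      fun _ _ => rfl, fun _ _ _ _ => rfl⟩
  | head h₁ _ ih =>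
    obtain ⟨ι, ψ, h⟩ := ih
    obtain ⟨i, α, c, x⟩ := h₁
    refine ⟨i.succAbove ∘ ι, coface i α ∘ ψ, (continuous_coface i α).comp h.continuous,
      (monotone_coface i α).comp h.monotone, by simp [h.point], ?_, fun z => ?_, fun y hy => ?_,
      fun f h₀ h₁ z => ?_⟩
    · rw [← h.select]
      funext k
      exact coface_succAbove i α x (ι k)
    · rw [← h.toReal_eq]
      exact (toReal_face i α c (ψ z)).symm
    · have := h.retract (fun j => y (i.succAbove j)) fun j => by
        simpa using hy (i.succAbove j)
      have hi := hy i
      simp only [coface_same] at hi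
      refine (coface_eq_iff _ _ _ _).2 ⟨?_, congrFun this⟩
      cases α
      · exact (hi.1 rfl).symm
      · exact (hi.2 rfl).symm
    · simp only [Function.comp_apply, h.comp f h₀ h₁]
      exact coface_comp h₀ h₁ _ _ _

/-! ### Coordinatewise self-maps of the realization -/

/-- A continuous non-decreasing self-map of the interval that fixes the end points. -/
structure IntervalMap where
  /-- the underlying function -/
  toFun : I → I
  continuous : Continuous toFun
  monotone : Monotone toFun
  map_zero : toFun 0 = 0
  map_one : toFun 1 = 1

/-- The self-map of the realization that applies `f` to all coordinates. -/
def act (f : IntervalMap) : X.Realization → X.Realization :=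
  Quot.lift (fun a => X.toReal a.1.2 (f.toFun ∘ a.2)) <| by
    rintro _ _ ⟨i, α, c, x⟩
    simp only [toReal_face, coface_comp f.map_zero f.map_one]

theorem act_toReal (f : IntervalMap) {n : ℕ} (c : X.cube n) (x : StdCube n) :
    act f (X.toReal c x) = X.toReal c (f.toFun ∘ x) := rfl

theorem act_vertexPt (f : IntervalMap) (v : X.cube 0) : act f (X.vertexPt v) = X.vertexPt v := by
  rw [vertexPt, act_toReal]
  congr 1
  exact Subsingleton.elim _ _

theorem continuous_toReal {n : ℕ} (c : X.cube n) : Continuous (X.toReal c) :=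
  continuous_quot_mk.comp (@continuous_sigmaMk _ (fun c : (Σ n, X.cube n) => StdCube c.1) _ ⟨n, c⟩)

theorem IntervalMap.continuous_comp (f : IntervalMap) {n : ℕ} :
    Continuous fun x : StdCube n => f.toFun ∘ x :=
  continuous_pi fun i => f.continuous.comp (continuous_apply i)

theorem continuous_act (f : IntervalMap) : Continuous (act (X := X) f) :=
  continuous_quot_lift _ <| continuous_sigma fun c =>
    (continuous_toReal c.2).comp f.continuous_comp

/-- The path obtained by applying `f` to all coordinates. -/
def actPath (f : IntervalMap) (p : C(I, X.Realization)) : C(I, X.Realization) :=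
  ⟨fun t => act f (p t), (continuous_act f).comp p.continuous⟩

/-- The presentation obtained by applying `f` to all coordinates. -/
def Presentation.map {p : C(I, X.Realization)} (P : X.Presentation p) (f : IntervalMap) :
    X.Presentation (actPath f p) where
  len := P.len
  time := P.time
  time_mono := P.time_mono
  time_zero := P.time_zero
  time_last := P.time_last
  dim := P.dim
  cell := P.cell
  seg i := ⟨fun s => f.toFun ∘ P.seg i s, f.continuous_comp.comp (P.seg i).continuous⟩
  seg_increasing i j s t h := f.monotone (P.seg_increasing i j s t h)
  eq_seg i s := by
    change act f (p s) = _
    rw [P.eq_seg]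
    rfl

theorem IsTame.actPath {p : C(I, X.Realization)} (h : X.IsTame p) (f : IntervalMap) :
    X.IsTame (actPath f p) := by
  obtain ⟨P, hP⟩ := h
  refine ⟨P.map f, fun i => ?_⟩
  obtain ⟨v, hv⟩ := hP i
  exact ⟨v, (congrArg (act f) hv).trans (act_vertexPt f v)⟩

theorem IsStrict.actPath {p : C(I, X.Realization)} (h : X.IsStrict p) {f : IntervalMap}
    (hf : ∀ x y, f.toFun x = f.toFun y → x = y ∨ f.toFun x = 0 ∨ f.toFun x = 1) :
    X.IsStrict (actPath f p) := by
  obtain ⟨P, hP⟩ := h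
  refine ⟨P.map f, fun i => ⟨(P.map f).seg_increasing i, fun j s t hst => ?_⟩⟩
  rcases hf _ _ hst with h | h
  · rcases (hP i).2 j s t h with h | h | h
    · exact .inl h
    · exact .inr (.inl ((congrArg f.toFun h).trans f.map_zero))
    · exact .inr (.inr ((congrArg f.toFun h).trans f.map_one))
  · exact .inr h

/-- The linear map that stretches the interval from its centre by the factor `max 1 r`, cut off at
the end points. -/
noncomputable def stretch (r : ℝ) : IntervalMap where
  toFun x := Set.projIcc 0 1 zero_le_one (1 / 2 + max 1 r * ((x : ℝ) - 1 / 2))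
  continuous := by fun_prop
  monotone := by
    intro x y h
    refine Set.monotone_projIcc _ ?_
    have : (x : ℝ) ≤ y := h
    gcongr
  map_zero := by
    refine Set.projIcc_of_le_left _ ?_
    have := le_max_left 1 r
    simp only [Set.Icc.coe_zero]
    linarith
  map_one := by
    refine Set.projIcc_of_right_le _ ?_
    have := le_max_left 1 r
    simp only [Set.Icc.coe_one]
    linarith

theorem stretch_one (x : I) : (stretch 1).toFun x = x := by
  have : (1 / 2 + max 1 1 * ((x : ℝ) - 1 / 2)) = x := by rw [max_self]; ring
  simp only [stretch, this, Set.projIcc_val]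

theorem stretch_eq_zero {r : ℝ} (hr₀ : 0 ≤ r) {x : I} (h : 1 / 2 ≤ r * (1 / 2 - x)) :
    (stretch r).toFun x = 0 := by
  refine Set.projIcc_of_le_left zero_le_one ?_
  have hx := x.2.1
  rcases le_total 1 r with hr | hr
  · rw [max_eq_right hr]; linarith
  · rw [max_eq_left hr]
    by_cases h0 : (x : ℝ) ≤ 1 / 2 <;> nlinarith [x.2.2]

theorem stretch_eq_one {r : ℝ} (hr₀ : 0 ≤ r) {x : I} (h : 1 / 2 ≤ r * (x - 1 / 2)) :
    (stretch r).toFun x = 1 := by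
  refine Set.projIcc_of_right_le zero_le_one ?_
  have hx := x.2.2
  rcases le_total 1 r with hr | hr
  · rw [max_eq_right hr]; linarith
  · rw [max_eq_left hr]
    by_cases h0 : 1 / 2 ≤ (x : ℝ) <;> nlinarith [x.2.1]

/-- Where it is not cut off, the map is affine of positive slope. -/
theorem stretch_injective (r : ℝ) (x y : I) (h : (stretch r).toFun x = (stretch r).toFun y) :
    x = y ∨ (stretch r).toFun x = 0 ∨ (stretch r).toFun x = 1 := by
  by_contra! hc
  have key : ∀ z : I, (stretch r).toFun z ≠ 0 → (stretch r).toFun z ≠ 1 →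
      ((stretch r).toFun z : ℝ) = 1 / 2 + max 1 r * ((z : ℝ) - 1 / 2) := by
    intro z h₀ h₁
    simp only [stretch, ne_eq] at h₀ h₁ ⊢
    rw [Set.projIcc_of_mem _ ⟨?_, ?_⟩]
    · by_contra! h; exact h₀ (Set.projIcc_of_le_left _ h.le)
    · by_contra! h; exact h₁ (Set.projIcc_of_right_le _ h.le)
  have hx := key x hc.2.1 hc.2.2
  have hy := key y (h ▸ hc.2.1) (h ▸ hc.2.2)
  rw [h, hy, add_right_inj] at hx
  have := mul_left_cancel₀ (by positivity) hx
  exact hc.1 (Subtype.ext (by linarith))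

theorem continuous_stretch : Continuous fun q : ℝ × I => (stretch q.1).toFun q.2 := by
  simp only [stretch]
  fun_prop

/-- A product of a quotient map with `ℝ` is handled by currying: continuity into `C(ℝ,
X.Realization)` can be tested on cubes, and uncurrying is continuous because `ℝ` is locally compact.
-/
theorem continuous_act_stretch :
    Continuous fun q : ℝ × X.Realization => act (stretch q.1) q.2 := by
  have h (c : Σ n, X.cube n) : Continuous fun q : StdCube c.1 × ℝ =>
      X.toReal c.2 ((stretch q.2).toFun ∘ q.1) := by
    refine (continuous_toReal c.2).comp (continuous_pi fun i => ?_)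
    exact continuous_stretch.comp (continuous_snd.prodMk ((continuous_apply i).comp continuous_fst))
  let Φ : X.Realization → C(ℝ, X.Realization) := fun x => ⟨fun r => act (stretch r) x, by
    obtain ⟨a, rfl⟩ := Quot.exists_rep x
    exact (h a.1).comp (Continuous.prodMk_right a.2)⟩
  have hΦ : Continuous Φ := by
    refine isQuotientMap_quot_mk.continuous_iff.2 (continuous_sigma fun c => ?_)
    exact ContinuousMap.continuous_of_continuous_uncurry _ (h c)
  have := ContinuousMap.continuous_uncurry_of_continuous ⟨Φ, hΦ⟩
  exact this.comp continuous_swap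

theorem continuous_actPath_stretch :
    Continuous fun q : ℝ × C(I, X.Realization) => actPath (stretch q.1) q.2 := by
  refine ContinuousMap.continuous_of_continuous_uncurry _ ?_
  refine continuous_act_stretch.comp (f := fun q : (ℝ × C(I, X.Realization)) × I =>
    (q.1.1, q.1.2 q.2)) ?_
  fun_prop

theorem actPath_stretch_one (p : C(I, X.Realization)) : actPath (stretch 1) p = p := by
  ext t
  change act _ (p t) = p t
  obtain ⟨⟨⟨n, c⟩, x⟩, h⟩ := Quot.exists_rep (p t)
  rw [← h]
  refine (act_toReal _ c x).trans (congrArg _ (funext fun i => stretch_one _))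

/-! ### Short directed paths are pushed into a single cube -/

/-- The sum of the coordinates, modulo `1`. -/
noncomputable def coordSum : X.Realization → AddCircle (1 : ℝ) :=
  Quot.lift (fun a => ((∑ j, (a.2 j : ℝ) : ℝ) : AddCircle (1 : ℝ))) <| by
    rintro _ _ ⟨i, α, c, x⟩
    simp only [Fin.sum_univ_succAbove _ i, coface_same, coface_succAbove, AddCircle.coe_add]
    cases α
    · simp [endpt]
    · simp [endpt, AddCircle.coe_period]

theorem coordSum_toReal {n : ℕ} (c : X.cube n) (x : StdCube n) :
    coordSum (X.toReal c x) = ((∑ j, (x j : ℝ) : ℝ) : AddCircle (1 : ℝ)) := rfl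

theorem continuous_coordSum : Continuous (coordSum (X := X)) := by
  refine continuous_quot_lift _ (continuous_sigma fun c => ?_)
  have : Continuous fun x : StdCube c.1 => ∑ j, (x j : ℝ) :=
    continuous_finsetSum _ fun j _ => continuous_subtype_val.comp (continuous_apply j)
  exact (AddCircle.continuous_mk' 1).comp this

/-- On `[s, t]` the path `p` runs in one cube, along a continuous increasing path. -/
def Seg (p : I → X.Realization) (s t : I) : Prop :=
  s ≤ t ∧ ∃ (n : ℕ) (c : X.cube n) (γ : I → StdCube n), Continuous γ ∧ Monotone γ ∧
    ∀ u ∈ Set.Icc s t, p u = X.toReal c (γ u)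

theorem Seg.refl (p : I → X.Realization) (s : I) : Seg p s s := by
  obtain ⟨⟨⟨n, c⟩, x⟩, h⟩ := Quot.exists_rep (p s)
  refine ⟨le_rfl, n, c, fun _ => x, continuous_const, monotone_const, fun u hu => ?_⟩
  rw [Set.Icc_self, Set.mem_singleton_iff] at hu
  rw [hu, ← h]
  rfl

/-- The map that collapses `[0, a]` to `0` and stretches `[a, 1]` linearly to the interval. -/
noncomputable def shrink (a : ℝ) (h₀ : 0 ≤ a) (h₁ : a < 1) : IntervalMap where
  toFun x := Set.projIcc 0 1 zero_le_one (((x : ℝ) - a) / (1 - a))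
  continuous := by fun_prop
  monotone := by
    intro x y h
    refine Set.monotone_projIcc _ ?_
    have : (x : ℝ) ≤ y := h
    have : 0 < 1 - a := by linarith
    gcongr
  map_zero := by
    refine Set.projIcc_of_le_left _ (div_nonpos_of_nonpos_of_nonneg ?_ ?_)
    · simpa using h₀
    · linarith
  map_one := by
    refine Set.projIcc_of_right_le _ ?_
    rw [Set.Icc.coe_one, div_self]
    linarith

theorem shrink_eq_zero {a : ℝ} (h₀ : 0 ≤ a) (h₁ : a < 1) {x : I}
    (h : (shrink a h₀ h₁).toFun x = 0) : (x : ℝ) ≤ a := by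
  have := (Set.projIcc_eq_left zero_lt_one).1 h
  by_contra! hx
  exact absurd this (not_le.2 (div_pos (by linarith) (by linarith)))

theorem shrink_eq_one {a : ℝ} (h₀ : 0 ≤ a) (h₁ : a < 1) {x : I}
    (h : (shrink a h₀ h₁).toFun x = 1) : x = 1 := by
  have := (Set.projIcc_eq_right zero_lt_one).1 h
  rw [one_le_div (by linarith)] at this
  exact le_antisymm x.2.2 (show (1 : ℝ) ≤ x by linarith)

/-- The map g is f after the affine section of `shrink a` with image `[a, 1]`. Hence `shrink a` is
universal among the maps that collapse `[0, a]`. -/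
theorem exists_comp_shrink {a : ℝ} (h₀ : 0 ≤ a) (h₁ : a < 1) (f : IntervalMap)
    (hf : ∀ x : I, (x : ℝ) ≤ a → f.toFun x = 0) :
    ∃ g : IntervalMap, ∀ x, f.toFun x = g.toFun ((shrink a h₀ h₁).toFun x) := by
  let g : IntervalMap :=
    { toFun := fun u => f.toFun (Set.projIcc 0 1 zero_le_one (a + (1 - a) * u))
      continuous := f.continuous.comp (by fun_prop)
      monotone := by
        refine f.monotone.comp fun x y h => Set.monotone_projIcc _ ?_
        have : (x : ℝ) ≤ y := h
        have : 0 ≤ 1 - a := by linarith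
        gcongr
      map_zero := by
        refine hf _ ?_
        simp [Set.coe_projIcc, h₀]
      map_one := by
        rw [Set.projIcc_of_right_le _ (by simp)]
        exact f.map_one }
  refine ⟨g, fun x => ?_⟩
  have h : 0 < 1 - a := by linarith
  rcases le_total (x : ℝ) a with hx | hx
  · have : (shrink a h₀ h₁).toFun x = 0 :=
      Set.projIcc_of_le_left zero_le_one (div_nonpos_of_nonpos_of_nonneg (by linarith) h.le)
    rw [this, g.map_zero, hf x hx]
  · have : ((shrink a h₀ h₁).toFun x : ℝ) = (x - a) / (1 - a) := by
      simp only [shrink]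
      rw [Set.projIcc_of_mem]
      exact ⟨div_nonneg (by linarith) h.le, (div_le_one h).2 (by linarith [x.2.2])⟩
    simp only [g, this]
    rw [mul_div_cancel₀ _ h.ne', add_sub_cancel, Set.projIcc_val]

/-- On `[s, r]` the path `p` is pushed into a single cube by all maps that collapse `[0, a]`. -/
def PushedIntoCube (p : I → X.Realization) (s r : I) (a : ℝ) : Prop :=
  ∃ (n : ℕ) (c : X.cube n), ∀ f : IntervalMap, (∀ x : I, (x : ℝ) ≤ a → f.toFun x = 0) →
    ∃ γ : I → StdCube n, Continuous γ ∧ Monotone γ ∧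
      ∀ u ∈ Set.Icc s r, act f (p u) = X.toReal c (γ u)

theorem PushedIntoCube.refl (p : I → X.Realization) (s : I) : PushedIntoCube p s s 0 := by
  obtain ⟨_, n, c, γ, h₁, h₂, h₃⟩ := Seg.refl p s
  refine ⟨n, c, fun f _ => ⟨fun u => f.toFun ∘ γ u, f.continuous_comp.comp h₁,
    fun u v h i => f.monotone (h₂ h i), fun u hu => ?_⟩⟩
  rw [h₃ u hu, act_toReal]

/-- At time r the shrunk path lies in the old cube b and in the new cube c, hence on a common face
e. On `[r, t]` no coordinate grows by more than the total increase, so a map f collapsing that much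
more keeps the path in c on the face e, from where it is transported into b. The cube b never
changes. -/
theorem PushedIntoCube.extend {p : I → X.Realization} {s r t : I} {a : ℝ}
    (h : PushedIntoCube p s r a) (hsr : s ≤ r) (hrt : r ≤ t) (h₀ : 0 ≤ a) {n : ℕ}
    (c : X.cube n) (β : I → StdCube n) (hβ : Continuous β) (hβm : Monotone β)
    (hp : ∀ u ∈ Set.Icc r t, p u = X.toReal c (β u))
    (h₁ : a + ∑ j, ((β t j : ℝ) - β r j) < 1) :
    PushedIntoCube p s t (a + ∑ j, ((β t j : ℝ) - β r j)) := by
  have hnn : ∀ j, 0 ≤ (β t j : ℝ) - β r j := fun j => sub_nonneg.2 (hβm hrt j)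
  have hsum : 0 ≤ ∑ j, ((β t j : ℝ) - β r j) := Finset.sum_nonneg fun j _ => hnn j
  obtain ⟨m, b, H⟩ := h
  refine ⟨m, b, fun f hf => ?_⟩
  have ha₁ : a < 1 := by linarith
  -- The hypothesis is used for `shrink a` and not for f: it sends only `[0, a]` to 0 and only 1 to
  -- 1, so the end point coordinates at time r give bounds on `β r`.
  obtain ⟨γ, hγ, hγm, hγp⟩ := H (shrink a h₀ ha₁) fun x hx =>
    Set.projIcc_of_le_left zero_le_one
      (div_nonpos_of_nonpos_of_nonneg (by linarith) (by linarith))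
  have hr := hγp r ⟨hsr, le_rfl⟩
  rw [hp r ⟨le_rfl, hrt⟩, act_toReal] at hr
  obtain ⟨⟨⟨k, e⟩, w⟩, hd₁, hd₂⟩ := join_red_of_toReal_eq hr
  obtain ⟨ι₁, ψ₁, h₁⟩ := exists_faceData hd₁
  obtain ⟨ι₂, ψ₂, h₂⟩ := exists_faceData hd₂
  simp only at ι₁ ψ₁ h₁ ι₂ ψ₂ h₂
  obtain ⟨g, hg⟩ := exists_comp_shrink h₀ ha₁ f fun x hx => hf x (by linarith)
  -- Select the coordinates of e from the new cube c, then include e into the old cube b.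
  set δ : I → StdCube m := fun u => ψ₂ ((f.toFun ∘ β u) ∘ ι₁) with hδ
  have hδc : Continuous δ := h₂.continuous.comp <| continuous_pi fun i =>
    f.continuous.comp ((continuous_apply _).comp hβ)
  have hδm : Monotone δ := fun u v huv => h₂.monotone fun i => f.monotone (hβm huv _)
  have hδr : g.toFun ∘ γ r = δ r := by
    have : (f.toFun ∘ β r) ∘ ι₁ = g.toFun ∘ w := by
      rw [← h₁.select]
      funext i
      exact hg _
    rw [hδ]
    simp only
    rw [this, h₂.comp _ g.map_zero g.map_one, h₂.point]
  refine ⟨fun u => if u ≤ r then g.toFun ∘ γ u else δ u,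
    Continuous.if_le (g.continuous_comp.comp hγ) hδc continuous_id continuous_const
      (fun u hu => by rw [hu]; exact hδr), fun u v huv => ?_, fun u hu => ?_⟩
  · have hgm : Monotone fun u => g.toFun ∘ γ u := fun u v h i => g.monotone (hγm h i)
    by_cases hv : v ≤ r
    · simp only [if_pos hv, if_pos (huv.trans hv)]
      exact hgm huv
    · rw [not_le] at hv
      by_cases hu : u ≤ r
      · simp only [if_pos hu, if_neg hv.not_ge]
        exact (hgm hu).trans (hδr.le.trans (hδm hv.le))
      · simp only [if_neg hu, if_neg hv.not_ge]
        exact hδm huv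
  · by_cases hur : u ≤ r
    · simp only [if_pos hur]
      rw [← act_toReal, ← hγp u ⟨hu.1, hur⟩]
      obtain ⟨⟨⟨l, d⟩, x⟩, hx⟩ := Quot.exists_rep (p u)
      rw [← hx]
      exact congrArg (X.toReal d) (funext fun i => hg _)
    · simp only [if_neg hur]
      rw [not_le] at hur
      rw [hp u ⟨hur.le, hu.2⟩, act_toReal, hδ, h₂.toReal_eq, ← h₁.toReal_eq, h₁.retract]
      intro j
      -- A coordinate shrunk to 0 at time r was at most a, so it is still collapsed by f at time u;
      -- one shrunk to 1 was already 1 and remains so.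
      refine ⟨fun hj => hf _ ?_, fun hj => ?_⟩
      · have h3 := shrink_eq_zero h₀ ha₁ hj
        have h4 : (β u j : ℝ) ≤ β t j := hβm hu.2 j
        have h5 := Finset.single_le_sum (f := fun j => (β t j : ℝ) - β r j)
          (fun j _ => hnn j) (Finset.mem_univ j)
        linarith
      · have h3 := shrink_eq_one h₀ ha₁ hj
        have h4 : β r j ≤ β u j := hβm hur.le j
        rw [h3] at h4
        exact (congrArg f.toFun (le_antisymm (β u j).2.2 h4)).trans f.map_one

/-- Induction along the chain of segments, where a is the real total increase of the coordinate sums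
so far, a lift of the difference of `coordSum`. -/
theorem exists_pushedIntoCube {p : I → X.Realization} {s t : I}
    (h : Relation.ReflTransGen (Seg p) s t)
    (hp : ∀ u ∈ Set.Icc s t, ‖coordSum (p u) - coordSum (p s)‖ < 1 / 8) :
    s ≤ t ∧ ∃ a : ℝ, 0 ≤ a ∧ a < 1 / 8 ∧
      coordSum (p t) - coordSum (p s) = (a : AddCircle (1 : ℝ)) ∧ PushedIntoCube p s t a := by
  induction h with
  | refl => exact ⟨le_rfl, 0, le_rfl, by norm_num, by simp, PushedIntoCube.refl p s⟩
  | @tail r t _ hrt ih =>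
    obtain ⟨hrt, n, c, β, hβ, hβm, hc⟩ := hrt
    obtain ⟨hsr, a, h₀, h₁, ha, H⟩ := ih fun u hu => hp u ⟨hu.1, hu.2.trans hrt⟩
    have hnn : ∀ j, 0 ≤ (β t j : ℝ) - β r j := fun j => sub_nonneg.2 (hβm hrt j)
    have hsum : 0 ≤ ∑ j, ((β t j : ℝ) - β r j) := Finset.sum_nonneg fun j _ => hnn j
    have hval : ∀ u ∈ Set.Icc r t, coordSum (p u) - coordSum (p s) =
        ((a + ∑ j, ((β u j : ℝ) - β r j) : ℝ) : AddCircle (1 : ℝ)) := by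
      intro u hu
      rw [← sub_add_sub_cancel _ (coordSum (p r)), ha, hc u hu, hc r ⟨le_rfl, hrt⟩,
        coordSum_toReal, coordSum_toReal, Finset.sum_sub_distrib, AddCircle.coe_add,
        AddCircle.coe_sub, add_comm]
    have hlt : a + ∑ j, ((β t j : ℝ) - β r j) < 1 / 8 := by
      by_contra! hge
      -- The hypothesis bounds the increase only modulo 1. If the lift reached 1/8, it would equal
      -- 1/8 at some time by the intermediate value theorem, and there the norm in the circle would
      -- be exactly 1/8.
      have hcont : Continuous fun u : I => a + ∑ j, ((β (max r (min u t)) j : ℝ) - β r j) := by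
        fun_prop
      obtain ⟨u, hu⟩ : (1 / 8 : ℝ) ∈ Set.range
          fun u : I => a + ∑ j, ((β (max r (min u t)) j : ℝ) - β r j) := by
        refine intermediate_value_univ r t hcont ⟨?_, ?_⟩
        · simpa [min_eq_left hrt] using h₁.le
        · simpa [max_eq_right hrt] using hge
      have hmem : max r (min u t) ∈ Set.Icc r t := ⟨le_max_left _ _, max_le hrt (min_le_right _ _)⟩
      have h3 := hp _ ⟨hsr.trans hmem.1, hmem.2⟩
      simp only at hu
      rw [hval _ hmem, hu,
        (AddCircle.norm_coe_eq_abs_iff _ one_ne_zero).2 (by norm_num [abs_of_pos])] at h3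
      norm_num [abs_of_pos] at h3
    exact ⟨hsr.trans hrt, _, by positivity, hlt, hval t ⟨hrt, le_rfl⟩,
      H.extend hsr hrt h₀ c β hβ hβm hc (by linarith)⟩

/-- A short directed path is pushed into a single cube by the maps that collapse `[0, 1/8]`. -/
theorem seg_act_of_short {p : I → X.Realization} {s t : I}
    (h : Relation.ReflTransGen (Seg p) s t)
    (hp : ∀ u ∈ Set.Icc s t, ‖coordSum (p u) - coordSum (p s)‖ < 1 / 8) (f : IntervalMap)
    (hf : ∀ x : I, (x : ℝ) ≤ 1 / 8 → f.toFun x = 0) : Seg (fun u => act f (p u)) s t := by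
  obtain ⟨hst, a, _, ha, _, n, c, H⟩ := exists_pushedIntoCube h hp
  exact ⟨hst, n, c, H f fun x hx => hf x (by linarith)⟩

/-! ### Presentations as chains of segments -/

theorem Presentation.seg_time {p : C(I, X.Realization)} (P : X.Presentation p) (i : Fin P.len) :
    Seg p (P.time i.castSucc) (P.time i.succ) := by
  have h : P.time i.castSucc ≤ P.time i.succ := P.time_mono i.castSucc_lt_succ.le
  refine ⟨h, P.dim i, P.cell i, fun u => P.seg i (Set.projIcc _ _ h u), by fun_prop,
    fun u v huv j => P.seg_increasing i j _ _ (Set.monotone_projIcc h huv), fun u hu => ?_⟩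
  simp only [Set.projIcc_of_mem h hu]
  exact P.eq_seg i ⟨u, hu⟩

theorem Presentation.reflTransGen_seg {p : C(I, X.Realization)} (P : X.Presentation p) :
    Relation.ReflTransGen (Seg p) 0 1 := by
  have h (k : Fin (P.len + 1)) : Relation.ReflTransGen (Seg p) 0 (P.time k) := by
    induction k using Fin.induction with
    | zero => rw [P.time_zero]
    | succ i ih => exact ih.tail (P.seg_time i)
  simpa [P.time_last] using h (Fin.last _)

/-- Truncation to `[s, t]` either makes the interval degenerate, where any point will do, or gives a
subinterval of `[u, v]`. -/
theorem Seg.clamp {p : I → X.Realization} {u v : I} (h : Seg p u v) (s t : I) :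
    Seg p (max s (min u t)) (max s (min v t)) := by
  by_cases he : max s (min u t) = max s (min v t)
  · rw [he]
    exact Seg.refl p _
  obtain ⟨huv, n, c, γ, h₁, h₂, h₃⟩ := h
  refine ⟨max_le_max le_rfl (min_le_min huv le_rfl), n, c, γ, h₁, h₂, fun w hw => h₃ w ⟨?_, ?_⟩⟩
  · rcases le_total u t with hu | hu
    · exact (le_max_right _ _).trans ((min_eq_left hu ▸ hw.1))
    · exact absurd (by rw [min_eq_right hu, min_eq_right (hu.trans huv)]) he
  · rcases le_total s v with hv | hv
    · exact hw.2.trans (max_le hv (min_le_left _ _))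
    · refine absurd ?_ he
      rw [max_eq_left ((min_le_left _ _).trans hv),
        max_eq_left ((min_le_left _ _).trans (huv.trans hv))]

theorem Presentation.reflTransGen_seg_of_le {p : C(I, X.Realization)} (P : X.Presentation p)
    {s t : I} (hst : s ≤ t) : Relation.ReflTransGen (Seg p) s t := by
  have := P.reflTransGen_seg.lift (p := Seg p) (fun u => max s (min u t))
    fun u v h => Seg.clamp h s t
  simpa [Function.onFun, min_eq_left (show (0 : I) ≤ t from t.2.1),
    min_eq_right (show t ≤ 1 from t.2.2), max_eq_left (show (0 : I) ≤ s from s.2.1),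
    max_eq_right hst] using this

/-- A segment of a path that ends at a vertex. -/
def VertexSeg (p : I → X.Realization) (s t : I) : Prop :=
  Seg p s t ∧ ∃ v, p t = X.vertexPt v

theorem exists_sequence_of_reflTransGen {α : Type*} {r : α → α → Prop} {a b : α}
    (h : Relation.ReflTransGen r a b) :
    ∃ (l : ℕ) (τ : ℕ → α), τ 0 = a ∧ τ l = b ∧ ∀ i < l, r (τ i) (τ (i + 1)) := by
  induction h with
  | refl => exact ⟨0, fun _ => a, rfl, rfl, by simp⟩
  | @tail b c _ hbc ih =>
    obtain ⟨l, τ, h₀, h₁, h⟩ := ih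
    refine ⟨l + 1, fun i => if i ≤ l then τ i else c, by simpa, by simp, fun i hi => ?_⟩
    rcases Nat.lt_succ_iff_lt_or_eq.1 hi with hi | rfl
    · simpa [hi.le, Nat.succ_le_of_lt hi] using h i hi
    · simpa [h₁] using hbc

theorem isTame_of_reflTransGen {p : C(I, X.Realization)} {x : X.cube 0} (h₀ : p 0 = X.vertexPt x)
    (h : Relation.ReflTransGen (VertexSeg p) 0 1) : X.IsTame p := by
  obtain ⟨l, τ, hτ₀, hτ₁, hτ⟩ := exists_sequence_of_reflTransGen h
  choose n c γ h₁ h₂ h₃ using fun i : Fin l => (hτ i i.2).1.2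
  refine ⟨⟨l, fun i => τ i, Fin.monotone_iff_le_succ.2 fun i => (hτ i i.2).1.1, hτ₀, by simpa,
    n, c, fun i => ⟨fun u => γ i u, (h₁ i).comp continuous_subtype_val⟩,
    fun i j s t hst => h₂ i hst j, fun i s => h₃ i s s.2⟩, fun i => ?_⟩
  induction i using Fin.cases with
  | zero => exact ⟨x, by simp only [Fin.val_zero, hτ₀, h₀]⟩
  | succ i => exact (hτ i i.2).2

theorem toReal_eq_vertexPt {n : ℕ} (c : X.cube n) (x : StdCube n)
    (hx : ∀ j, x j = 0 ∨ x j = 1) : ∃ v, X.toReal c x = X.vertexPt v := by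
  induction n with
  | zero => exact ⟨c, congrArg _ (Subsingleton.elim _ _)⟩
  | succ n ih =>
    obtain ⟨α, hα⟩ : ∃ α, endpt α = x 0 := by
      rcases hx 0 with h | h
      · exact ⟨false, h.symm⟩
      · exact ⟨true, h.symm⟩
    have : coface 0 α (fun j => x (Fin.succAbove 0 j)) = x :=
      (coface_eq_iff _ _ _ _).2 ⟨hα, fun _ => rfl⟩
    rw [← this, ← toReal_face]
    exact ih _ _ fun j => hx _

/-! ### The distance of the coordinates from the centre -/

/-- The product of the normalized distances of the coordinates from the centre of the interval. -/
noncomputable def centreDist : X.Realization → ℝ :=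
  Quot.lift (fun a => ∏ j, |2 * (a.2 j : ℝ) - 1|) <| by
    rintro _ _ ⟨i, α, c, x⟩
    simp only [Fin.prod_univ_succAbove _ i, coface_same, coface_succAbove]
    cases α <;> norm_num [endpt]

theorem centreDist_toReal {n : ℕ} (c : X.cube n) (x : StdCube n) :
    centreDist (X.toReal c x) = ∏ j, |2 * (x j : ℝ) - 1| := rfl

theorem continuous_centreDist : Continuous (centreDist (X := X)) := by
  refine continuous_quot_lift _ (continuous_sigma fun c => ?_)
  have h (j : Fin c.1) : Continuous fun x : StdCube c.1 => (x j : ℝ) :=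
    continuous_subtype_val.comp (continuous_apply j)
  exact (continuous_finsetProd _ fun j _ => by fun_prop :
    Continuous fun x : StdCube c.1 => ∏ j, |2 * (x j : ℝ) - 1|)

theorem abs_two_mul_sub_one_le (x : I) : |2 * (x : ℝ) - 1| ≤ 1 :=
  abs_le.2 ⟨by linarith [x.2.1], by linarith [x.2.2]⟩

theorem centreDist_mem (x : X.Realization) : centreDist x ∈ Set.Icc (0 : ℝ) 1 := by
  obtain ⟨⟨⟨n, c⟩, x⟩, rfl⟩ := Quot.exists_rep x
  exact ⟨Finset.prod_nonneg fun _ _ => abs_nonneg _,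
    Finset.prod_le_one (fun _ _ => abs_nonneg _) fun _ _ => abs_two_mul_sub_one_le _⟩

/-- All factors of the product are at most 1, so each is at least η, and the factor 1/η moves such
coordinates to the end points. -/
theorem act_stretch_eq_vertexPt {x : X.Realization} {η : ℝ} (hη : 0 < η)
    (hx : η ≤ centreDist x) : ∃ v, act (stretch (1 / η)) x = X.vertexPt v := by
  obtain ⟨⟨⟨n, c⟩, x⟩, rfl⟩ := Quot.exists_rep x
  refine toReal_eq_vertexPt c _ fun j => ?_
  have h : η ≤ |2 * (x j : ℝ) - 1| := by
    refine hx.trans ((centreDist_toReal c x).le.trans ?_)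
    rw [← Finset.mul_prod_erase _ _ (Finset.mem_univ j)]
    exact mul_le_of_le_one_right (abs_nonneg _) (Finset.prod_le_one (fun _ _ => abs_nonneg _)
      fun _ _ => abs_two_mul_sub_one_le _)
  have hη' : 0 ≤ 1 / η := by positivity
  rcases le_abs.1 h with h | h
  · refine .inr (stretch_eq_one hη' ?_)
    rw [one_div_mul_eq_div, le_div_iff₀ hη]
    linarith
  · refine .inl (stretch_eq_zero hη' ?_)
    rw [one_div_mul_eq_div, le_div_iff₀ hη]
    linarith

theorem Presentation.eq_zero_or_exists_mem {p : C(I, X.Realization)} (P : X.Presentation p)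
    (u : I) : u = 0 ∨ ∃ i : Fin P.len, u ∈ Set.Icc (P.time i.castSucc) (P.time i.succ) := by
  have h (k : Fin (P.len + 1)) : u ≤ P.time k →
      u = 0 ∨ ∃ i : Fin P.len, u ∈ Set.Icc (P.time i.castSucc) (P.time i.succ) := by
    induction k using Fin.induction with
    | zero => exact fun h => .inl (le_antisymm (P.time_zero ▸ h) u.2.1)
    | succ i ih =>
      intro hi
      rcases le_total u (P.time i.castSucc) with h | h
      · exact ih h
      · exact .inr ⟨i, h, hi⟩
  exact h (Fin.last _) (P.time_last ▸ u.2.2)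

/-- The product vanishes exactly when some coordinate is 1/2, a value that a strictly increasing
segment takes at most once per coordinate. -/
theorem IsStrict.finite_centreDist_eq_zero {p : C(I, X.Realization)} (h : X.IsStrict p) :
    {u : I | centreDist (p u) = 0}.Finite := by
  obtain ⟨P, hP⟩ := h
  let S (i : Fin P.len) (j : Fin (P.dim i)) :
      Set (Set.Icc (P.time i.castSucc) (P.time i.succ)) := {u | |2 * (P.seg i u j : ℝ) - 1| = 0}
  have hS (i j) : (S i j).Subsingleton := by
    intro u hu v hv
    have hu' : (P.seg i u j : ℝ) = 1 / 2 := by linarith [abs_eq_zero.1 hu]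
    have hv' : (P.seg i v j : ℝ) = 1 / 2 := by linarith [abs_eq_zero.1 hv]
    rcases (hP i).2 j u v (Subtype.ext (hu'.trans hv'.symm)) with h | h | h
    · exact h
    · rw [h] at hu'; norm_num at hu'
    · rw [h] at hu'; norm_num at hu'
  refine Set.Finite.subset (s := {0} ∪ ⋃ i, ⋃ j, Subtype.val '' S i j)
    ((Set.finite_singleton 0).union <| Set.finite_iUnion fun i => Set.finite_iUnion fun j =>
      ((hS i j).finite.image _)) fun u hu => ?_
  rcases P.eq_zero_or_exists_mem u with h | ⟨i, hi⟩
  · exact .inl h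
  · right
    have hu' : centreDist (p u) = 0 := hu
    rw [P.eq_seg i ⟨u, hi⟩, centreDist_toReal, Finset.prod_eq_zero_iff] at hu'
    obtain ⟨j, _, hj⟩ := hu'
    exact Set.mem_iUnion₂.2 ⟨i, j, ⟨u, hi⟩, hj, rfl⟩

theorem IsStrict.exists_centreDist_pos {p : C(I, X.Realization)} (h : X.IsStrict p) {s t : I}
    (hst : s < t) : ∃ u ∈ Set.Icc s t, 0 < centreDist (p u) := by
  obtain ⟨u, hu, hu'⟩ := (Set.Icc_infinite hst).exists_notMem_finite h.finite_centreDist_eq_zero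
  exact ⟨u, hu, lt_of_le_of_ne (centreDist_mem _).1 (Ne.symm hu')⟩

/-! ### The choice of the stretching factor -/

/-- The point `k / (N + 1)` of the interval. -/
noncomputable def gridPt (N k : ℕ) : I := Set.projIcc 0 1 zero_le_one (k / (N + 1))

theorem gridPt_zero (N : ℕ) : gridPt N 0 = 0 := Set.projIcc_of_le_left _ (by simp)

theorem coe_gridPt {N k : ℕ} (h : k ≤ N + 1) : (gridPt N k : ℝ) = k / (N + 1) := by
  have : (k : ℝ) ≤ N + 1 := mod_cast h
  rw [gridPt, Set.projIcc_of_mem]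
  exact ⟨by positivity, (div_le_one (by positivity)).2 this⟩

theorem gridPt_lt_succ {N k : ℕ} (h : k ≤ N) : gridPt N k < gridPt N (k + 1) := by
  rw [← Subtype.coe_lt_coe, coe_gridPt (by lia), coe_gridPt (by lia)]
  push_cast
  gcongr
  simp

theorem dist_le_of_mem_grid {N k : ℕ} (h : k ≤ N) {u v : I} (hu : gridPt N k ≤ u) (huv : u ≤ v)
    (hv : (v : ℝ) ≤ (k + 2) / (N + 1)) : dist u v ≤ 2 / (N + 1) := by
  have h₁ : (gridPt N k : ℝ) ≤ u := hu
  have h₂ : (u : ℝ) ≤ v := huv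
  rw [coe_gridPt (by lia)] at h₁
  rw [add_div] at hv
  rw [Subtype.dist_eq, dist_comm, Real.dist_eq, abs_of_nonneg (by linarith)]
  linarith

/-- The supremum of the distance from the centre on an interval of the grid. -/
noncomputable def gridSup (N k : ℕ) (p : C(I, X.Realization)) : ℝ :=
  sSup ((fun t => centreDist (p t)) '' Set.Icc (gridPt N k) (gridPt N (k + 1)))

/-- The oscillation of the sum of the coordinates at the scale of the grid. -/
noncomputable def gridOsc (N : ℕ) (p : C(I, X.Realization)) : ℝ :=
  sSup ((fun q : I × I => ‖coordSum (p q.1) - coordSum (p q.2)‖) ''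
    {q | dist q.1 q.2 ≤ 2 / (N + 1)})

/-- If positive, it is a lower bound of the distance from the centre at some point of each interval
of the grid, and the oscillation at the scale of the grid is small. -/
noncomputable def gridBound (N : ℕ) (p : C(I, X.Realization)) : ℝ :=
  min (∏ k ∈ Finset.range (N + 1), gridSup N k p) (max 0 (1 / 8 - gridOsc N p))

theorem isCompact_setOf_dist_le (r : ℝ) : IsCompact {q : I × I | dist q.1 q.2 ≤ r} :=
  (isClosed_le (by fun_prop) continuous_const).isCompact

/-- The supremum over a compact interval is continuous in p although a time where it is attained
need not be. -/
theorem continuous_gridSup (N k : ℕ) : Continuous (gridSup (X := X) N k) :=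
  IsCompact.continuous_sSup (f := fun (p : C(I, X.Realization)) t => centreDist (p t))
    isCompact_Icc (continuous_centreDist.comp (by fun_prop))

theorem continuous_gridOsc (N : ℕ) : Continuous (gridOsc (X := X) N) := by
  refine IsCompact.continuous_sSup (f := fun (p : C(I, X.Realization)) (q : I × I) =>
    ‖coordSum (p q.1) - coordSum (p q.2)‖) (isCompact_setOf_dist_le _) ?_
  have h := continuous_coordSum (X := X)
  change Continuous fun a : C(I, X.Realization) × (I × I) =>
    ‖coordSum (a.1 a.2.1) - coordSum (a.1 a.2.2)‖
  exact ((h.comp (by fun_prop)).sub (h.comp (by fun_prop))).norm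

theorem continuous_gridBound (N : ℕ) : Continuous (gridBound (X := X) N) := by
  have h₁ := continuous_gridOsc (X := X) N
  have h₂ : Continuous fun p : C(I, X.Realization) =>
      ∏ k ∈ Finset.range (N + 1), gridSup N k p :=
    continuous_finsetProd _ fun k _ => continuous_gridSup N k
  unfold gridBound
  fun_prop

theorem exists_gridSup_eq {N k : ℕ} (hk : k ≤ N) (p : C(I, X.Realization)) :
    ∃ t ∈ Set.Icc (gridPt N k) (gridPt N (k + 1)), gridSup N k p = centreDist (p t) :=
  isCompact_Icc.exists_sSup_image_eq ⟨_, le_rfl, (gridPt_lt_succ hk).le⟩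
    (continuous_centreDist.comp p.continuous).continuousOn

theorem gridSup_mem {N k : ℕ} (hk : k ≤ N) (p : C(I, X.Realization)) :
    gridSup N k p ∈ Set.Icc (0 : ℝ) 1 := by
  obtain ⟨t, _, h⟩ := exists_gridSup_eq hk p
  rw [h]
  exact centreDist_mem _

theorem IsStrict.gridSup_pos {p : C(I, X.Realization)} (hp : X.IsStrict p) {N k : ℕ}
    (hk : k ≤ N) : 0 < gridSup N k p := by
  obtain ⟨u, hu, hu'⟩ := hp.exists_centreDist_pos (gridPt_lt_succ hk)
  refine hu'.trans_le (le_csSup ⟨1, ?_⟩ ⟨u, hu, rfl⟩)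
  rintro _ ⟨v, _, rfl⟩
  exact (centreDist_mem _).2

theorem norm_sub_le_gridOsc {N : ℕ} (p : C(I, X.Realization)) {u v : I}
    (h : dist u v ≤ 2 / (N + 1)) : ‖coordSum (p u) - coordSum (p v)‖ ≤ gridOsc N p := by
  have hc := continuous_coordSum (X := X)
  refine le_csSup ((isCompact_setOf_dist_le _).bddAbove_image (Continuous.continuousOn ?_))
    ⟨(u, v), h, rfl⟩
  exact ((hc.comp (by fun_prop)).sub (hc.comp (by fun_prop))).norm

theorem gridBound_le (N : ℕ) (p : C(I, X.Realization)) :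
    ∀ k ≤ N, gridBound N p ≤ gridSup N k p := by
  intro k hk
  refine (min_le_left _ _).trans ?_
  have hm : ∀ i ∈ Finset.range (N + 1), i ≤ N := fun i hi => by simpa [Nat.lt_succ_iff] using hi
  rw [← Finset.mul_prod_erase _ _ (Finset.mem_range.2 (Nat.lt_succ_of_le hk))]
  exact mul_le_of_le_one_right (gridSup_mem hk p).1 (Finset.prod_le_one
    (fun i hi => (gridSup_mem (hm i (Finset.mem_of_mem_erase hi)) p).1)
    fun i hi => (gridSup_mem (hm i (Finset.mem_of_mem_erase hi)) p).2)

theorem gridOsc_nonneg (N : ℕ) (p : C(I, X.Realization)) : 0 ≤ gridOsc N p :=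
  (norm_nonneg _).trans (norm_sub_le_gridOsc (u := 0) (v := 0) p (by rw [dist_self]; positivity))

theorem gridBound_mem (N : ℕ) (p : C(I, X.Realization)) :
    gridBound N p ∈ Set.Icc (0 : ℝ) (1 / 8) := by
  refine ⟨le_min (Finset.prod_nonneg fun k hk => (gridSup_mem ?_ p).1) (le_max_left _ _),
    (min_le_right _ _).trans (max_le (by norm_num) (by linarith [gridOsc_nonneg N p]))⟩
  simpa [Nat.lt_succ_iff] using hk

/-- Uniform continuity of the coordinate sum along p; the supremum is attained, so the inequality
stays strict. -/
theorem exists_gridOsc_lt (p : C(I, X.Realization)) : ∃ N, gridOsc N p < 1 / 8 := by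
  have hc : Continuous fun t => coordSum (p t) := continuous_coordSum.comp p.continuous
  obtain ⟨δ, hδ, h⟩ := Metric.uniformContinuous_iff.1
    (CompactSpace.uniformContinuous_of_continuous hc) (1 / 8) (by norm_num)
  obtain ⟨N, hN⟩ := exists_nat_one_div_lt (half_pos hδ)
  refine ⟨N, ?_⟩
  obtain ⟨q, hq, he⟩ := (isCompact_setOf_dist_le (2 / ((N : ℝ) + 1))).exists_sSup_image_eq
    ⟨(0, 0), by simp only [Set.mem_ofPred_eq, dist_self]; positivity⟩
    (f := fun q : I × I => ‖coordSum (p q.1) - coordSum (p q.2)‖)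
    ((hc.comp continuous_fst).sub (hc.comp continuous_snd)).norm.continuousOn
  rw [gridOsc, he, ← dist_eq_norm]
  refine h (lt_of_le_of_lt hq ?_)
  rw [← mul_one_div]
  linarith

theorem IsStrict.exists_gridBound_pos {p : C(I, X.Realization)} (hp : X.IsStrict p) :
    ∃ N, 0 < gridBound N p := by
  obtain ⟨N, hN⟩ := exists_gridOsc_lt p
  refine ⟨N, lt_min (Finset.prod_pos fun k hk => hp.gridSup_pos ?_)
    (lt_max_of_lt_right (by linarith))⟩
  simpa [Nat.lt_succ_iff] using hk

/-- A continuous function that is bounded by one of the numbers `gridBound N p` and positive at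
strict paths. -/
noncomputable def tameRadius (p : C(I, X.Realization)) : ℝ :=
  ∑' N : ℕ, (1 / 2) ^ (N + 1) * gridBound N p

theorem summable_half_pow_succ : Summable fun N : ℕ => (1 / 2 : ℝ) ^ (N + 1) :=
  (summable_nat_add_iff 1).2 summable_geometric_two

theorem tsum_half_pow_succ : ∑' N : ℕ, (1 / 2 : ℝ) ^ (N + 1) = 1 := by
  simp only [pow_succ, tsum_mul_right, tsum_geometric_two]
  norm_num

theorem norm_half_pow_mul_gridBound_le (N : ℕ) (p : C(I, X.Realization)) :
    ‖(1 / 2 : ℝ) ^ (N + 1) * gridBound N p‖ ≤ (1 / 2) ^ (N + 1) := by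
  obtain ⟨h₀, h₁⟩ := gridBound_mem N p
  rw [Real.norm_of_nonneg (by positivity)]
  exact mul_le_of_le_one_right (by positivity) (by linarith)

theorem summable_tameRadius (p : C(I, X.Realization)) :
    Summable fun N : ℕ => (1 / 2 : ℝ) ^ (N + 1) * gridBound N p :=
  .of_norm_bounded summable_half_pow_succ fun N => norm_half_pow_mul_gridBound_le N p

theorem continuous_tameRadius : Continuous (tameRadius (X := X)) :=
  continuous_tsum (fun N => continuous_const.mul (continuous_gridBound N)) summable_half_pow_succ
    norm_half_pow_mul_gridBound_le

theorem IsStrict.tameRadius_pos {p : C(I, X.Realization)} (hp : X.IsStrict p) :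
    0 < tameRadius p := by
  obtain ⟨N, hN⟩ := hp.exists_gridBound_pos
  exact (summable_tameRadius p).tsum_pos (fun k => mul_nonneg (by positivity) (gridBound_mem k p).1)
    N (by positivity)

/-- The weights sum to 1, so the mean cannot exceed every term. The index N need not depend
continuously on p, since only tameness is deduced from it. -/
theorem exists_tameRadius_le (p : C(I, X.Realization)) : ∃ N, tameRadius p ≤ gridBound N p := by
  by_contra! h
  have : tameRadius p < ∑' N : ℕ, (1 / 2 : ℝ) ^ (N + 1) * tameRadius p :=
    (summable_tameRadius p).tsum_lt_tsum (i := 0)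
      (fun N => mul_le_mul_of_nonneg_left (h N).le (by positivity))
      (mul_lt_mul_of_pos_left (h 0) (by positivity)) (summable_half_pow_succ.mul_right _)
  rw [tsum_mul_right, tsum_half_pow_succ, one_mul] at this
  exact lt_irrefl _ this

/-- Each grid interval contains a time that is moved to a vertex. Consecutive such times are at most
two grid steps apart, so between them p is short and is pushed into one cube. -/
theorem isTame_actPath_stretch {p : C(I, X.Realization)} {x y : X.cube 0} (P : X.Presentation p)
    (h₀ : p 0 = X.vertexPt x) (h₁ : p 1 = X.vertexPt y) {η : ℝ} (hη : 0 < η) {N : ℕ}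
    (hN : η ≤ gridBound N p) : X.IsTame (actPath (stretch (1 / η)) p) := by
  have hη8 : η ≤ 1 / 8 := hN.trans (gridBound_mem N p).2
  have hosc : gridOsc N p < 1 / 8 := by
    by_contra! h
    have : gridBound N p ≤ 0 := (min_le_right _ _).trans (max_le le_rfl (by linarith))
    linarith
  have hstep {k : ℕ} (hk : k ≤ N) {s t : I} (hs : gridPt N k ≤ s) (hst : s ≤ t)
      (ht : (t : ℝ) ≤ (k + 2) / (N + 1))
      (hv : ∃ v, act (stretch (1 / η)) (p t) = X.vertexPt v) :
      VertexSeg (actPath (stretch (1 / η)) p) s t := by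
    refine ⟨seg_act_of_short (P.reflTransGen_seg_of_le hst) (fun u hu => ?_) _ fun z hz => ?_, hv⟩
    · refine lt_of_le_of_lt (norm_sub_le_gridOsc p ?_) hosc
      rw [dist_comm]
      exact dist_le_of_mem_grid hk hs hu.1 (le_trans hu.2 ht)
    -- From η ≤ 1/8 and z ≤ 1/8 it follows that η/2 ≤ 1/2 - z, so stretching by 1/η collapses `[0,
    -- 1/8]`.
    · refine stretch_eq_zero (by positivity) ?_
      rw [one_div_mul_eq_div, le_div_iff₀ hη]
      linarith
  choose τ hτ hτs using fun k : Fin (N + 1) => exists_gridSup_eq (Nat.lt_succ_iff.1 k.2) p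
  have hτv (k : Fin (N + 1)) : ∃ v, act (stretch (1 / η)) (p (τ k)) = X.vertexPt v :=
    act_stretch_eq_vertexPt hη
      ((hN.trans (gridBound_le N p k (Nat.lt_succ_iff.1 k.2))).trans (hτs k).le)
  have hτle (k : Fin (N + 1)) : (τ k : ℝ) ≤ (k + 1) / (N + 1) := by
    have : (τ k : ℝ) ≤ gridPt N (k + 1) := (hτ k).2
    rwa [coe_gridPt (by lia), Nat.cast_succ] at this
  have hchain (k : Fin (N + 1)) :
      Relation.ReflTransGen (VertexSeg (actPath (stretch (1 / η)) p)) 0 (τ k) := by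
    induction k using Fin.induction with
    | zero =>
      refine .single (hstep (Nat.zero_le N) (gridPt_zero N).le (τ 0).2.1 ?_ (hτv 0))
      refine (hτle 0).trans ?_
      gcongr <;> norm_num
    | succ k ih =>
      refine ih.tail (hstep (k := k) (by lia) (hτ k.castSucc).1
        ((hτ k.castSucc).2.trans (hτ k.succ).1) ?_ (hτv k.succ))
      refine (hτle k.succ).trans (le_of_eq ?_)
      rw [Fin.val_succ]
      push_cast
      ring
  refine isTame_of_reflTransGen (x := x) ((congrArg _ h₀).trans (act_vertexPt _ x)) ?_
  -- The last piece runs from the time chosen in the last grid interval to 1, where p is at the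
  -- vertex y.
  refine (hchain (Fin.last N)).tail (hstep le_rfl (hτ (Fin.last N)).1 (τ _).2.2 ?_
    ⟨y, (congrArg _ h₁).trans (act_vertexPt _ y)⟩)
  rw [le_div_iff₀ (by positivity)]
  simp only [Set.Icc.coe_one]
  linarith

/-- For the stretching factor `tameFactor p` the stretched path is tame. -/
noncomputable def tameFactor (p : C(I, X.Realization)) : ℝ := 1 / tameRadius p

theorem IsStrict.isTame_stretch {p : C(I, X.Realization)} {x y : X.cube 0} (hp : X.IsStrict p)
    (h₀ : p 0 = X.vertexPt x) (h₁ : p 1 = X.vertexPt y) :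
    X.IsTame (BoxSet.actPath (stretch (tameFactor p)) p) := by
  obtain ⟨P, _⟩ := id hp
  obtain ⟨N, hN⟩ := exists_tameRadius_le p
  exact isTame_actPath_stretch P h₀ h₁ hp.tameRadius_pos hN

/-! ### The deformation -/

theorem actPath_stretch_mem_strictPaths {x y : X.cube 0} {p : C(I, X.Realization)}
    (hp : p ∈ X.strictPaths x y) (r : ℝ) : actPath (stretch r) p ∈ X.strictPaths x y :=
  ⟨hp.1.actPath (stretch_injective r), (congrArg _ hp.2.1).trans (act_vertexPt _ x),
    (congrArg _ hp.2.2).trans (act_vertexPt _ y)⟩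

theorem actPath_stretch_mem_strictTamePaths {x y : X.cube 0} {p : C(I, X.Realization)}
    (hp : p ∈ X.strictTamePaths x y) (r : ℝ) :
    actPath (stretch r) p ∈ X.strictTamePaths x y :=
  have h := actPath_stretch_mem_strictPaths (X.strictTamePaths_subset x y hp) r
  ⟨⟨h.1, hp.1.2.actPath _⟩, h.2⟩

/-- The restriction to strict paths matters: there the radius is positive, so its inverse is
continuous. -/
theorem continuous_tameFactor (x y : X.cube 0) :
    Continuous fun p : X.strictPaths x y => tameFactor p.1 :=
  continuous_const.div (continuous_tameRadius.comp continuous_subtype_val)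
    fun p => p.2.1.tameRadius_pos.ne.symm

/-- The retraction up to homotopy of strict paths to strict tame paths. -/
noncomputable def tameRetraction (X : BoxSet.{u}) (x y : X.cube 0) :
    C(X.strictPaths x y, X.strictTamePaths x y) where
  toFun p := ⟨actPath (stretch (tameFactor p.1)) p.1,
    have h := actPath_stretch_mem_strictPaths p.2 (tameFactor p.1)
    ⟨⟨h.1, p.2.1.isTame_stretch p.2.2.1 p.2.2.2⟩, h.2⟩⟩
  continuous_toFun := (continuous_actPath_stretch.comp
    ((continuous_tameFactor x y).prodMk continuous_subtype_val)).subtype_mk _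

/-- The stretching factors interpolating between `1` and `tameFactor p`. -/
noncomputable def interpFactor (s : I) (p : C(I, X.Realization)) : ℝ :=
  (s : ℝ) + (1 - s) * tameFactor p

theorem continuous_interpFactor (x y : X.cube 0) :
    Continuous fun q : I × X.strictPaths x y => interpFactor q.1 q.2.1 := by
  have := (continuous_tameFactor x y).comp (continuous_snd (X := I))
  simp only [Function.comp_def] at this
  unfold interpFactor
  fun_prop

/-- The deformation of strict paths to strict tame paths. -/
noncomputable def strictHomotopy (X : BoxSet.{u}) (x y : X.cube 0) :
    ((X.tameInclusion x y).comp (tameRetraction X x y)).Homotopy (ContinuousMap.id _) where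
  toFun q := ⟨actPath (stretch (interpFactor q.1 q.2.1)) q.2.1,
    actPath_stretch_mem_strictPaths q.2.2 _⟩
  continuous_toFun := (continuous_actPath_stretch.comp
    ((continuous_interpFactor x y).prodMk
      (continuous_subtype_val.comp continuous_snd))).subtype_mk _
  map_zero_left p := Subtype.ext <| by
    simp only [interpFactor, Set.Icc.coe_zero, zero_add, sub_zero, one_mul]
    rfl
  map_one_left p := Subtype.ext <| by
    simp only [interpFactor, Set.Icc.coe_one, sub_self, zero_mul, add_zero]
    exact actPath_stretch_one p.1

/-- The deformation restricted to strict tame paths. -/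
noncomputable def strictTameHomotopy (X : BoxSet.{u}) (x y : X.cube 0) :
    ((tameRetraction X x y).comp (X.tameInclusion x y)).Homotopy (ContinuousMap.id _) where
  toFun q := ⟨actPath (stretch (interpFactor q.1 q.2.1)) q.2.1,
    actPath_stretch_mem_strictTamePaths q.2.2 _⟩
  continuous_toFun := (continuous_actPath_stretch.comp
    (((continuous_interpFactor x y).comp (continuous_fst.prodMk
      ((X.tameInclusion x y).continuous.comp continuous_snd))).prodMk
      (continuous_subtype_val.comp continuous_snd))).subtype_mk _
  map_zero_left p := Subtype.ext <| by
    simp only [interpFactor, Set.Icc.coe_zero, zero_add, sub_zero, one_mul]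
    rfl
  map_one_left p := Subtype.ext <| by
    simp only [interpFactor, Set.Icc.coe_one, sub_self, zero_mul, add_zero]
    exact actPath_stretch_one p.1

end BoxSet

theorem mainTheorem2 (X : BoxSet.{u}) (xminus xplus : X.cube 0) :
    IsHomotopyEquivalence (X.tameInclusion xminus xplus) := by
  exact ⟨⟨X.tameInclusion xminus xplus, X.tameRetraction xminus xplus,
    ⟨X.strictTameHomotopy xminus xplus⟩, ⟨X.strictHomotopy xminus xplus⟩⟩, rfl⟩
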